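/- Let $d\ge 1$, let $\Lambda\subset\mathbb{R}^{2d}$ be a (full-rank) lattice with a fixed bounded fundamental domain $F$, and let $l_M=\operatorname{diam}F$. For $z=(x,\omega)\in\mathbb{R}^{2d}$ and $f,g\in L^2(\mathbb{R}^d)$ put $\pi(z)f(t)=e^{2\pi i\omega\cdot t}f(t-x)$ and $V_gf(z)=\langle f,\pi(z)g\rangle$. Let $B(z,\rho)$ denote the open and $\overline{B}(z,\rho)$ the closed Euclidean ball in $\mathbb{R}^{2d}$. For $\Omega\subset\mathbb{R}^{2d}$ and $\rho>0$ write $\partial^{\rho}_\Lambda\Omega=\Lambda\cap(\partial\Omega+B(0,\rho))$. Let $g\in L^2(\mathbb{R}^d)$ satisfy $\sum_{\lambda\in\Lambda}|\lambda|\,|V_gg(\lambda)|^2<\infty$, and suppose that $(g,\Lambda)$ induces a tight Gabor frame with frame constant $1$, i.e. $\sum_{\lambda\in\Lambda}|V_gf(\lambda)|^2=\|f\|_{L^2}^2$ for all $f\in L^2(\mathbb{R}^d)$. For a compact set $\Omega\subset\mathbb{R}^{2d}$, write the Gabor multiplier $G_\Omega f=\sum_{\lambda\in\Lambda}\chi_\Omega(\lambda)V_gf(\lambda)\pi(\lambda)g$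 as $G_\Omega=\sum_{k\ge1}\lambda_k^\Omega\,h_k^\Omega\otimes h_k^\Omega$, where $(h_k^\Omega)_{k\ge1}$ is an orthonormal basis of $L^2(\mathbb{R}^d)$, $(h_k^\Omega\otimes h_k^\Omega)(f)=\langle f,h_k^\Omega\rangle h_k^\Omega$ and $\lambda_1^\Omega\ge\lambda_2^\Omega\ge\cdots$, and define the accumulated spectrogram $$\rho_\Omega(\lambda)=\frac{1}{\|g\|_{L^2}^2}\sum_{k=1}^{A_\Omega}|V_gh_k^\Omega(\lambda)|^2,\qquad A_\Omega=\big\lceil \#(\Omega\cap\Lambda)\,\|g\|_{L^2}^2\big\rceil .$$ **Theorem 1.3.** Let $r>0$, and assume that for some $C>0$ and $s>2d+1$, $$|V_gg(z)|\le C(1+|z|)^{-s}\quad\text{for all }z\in\mathbb{R}^{2d},\qquad V_gg(\lambda)\ne0\quad\text{for all }\lambda\in\Lambda\cap B(0,r+3l_M).$$ Then there exist constants $C_1,C_2>0$, depending only on $g$, on $\Lambda$ (with its fundamental domain $F$) and on $r$, such that for all $R>0$ (and every choice of the eigendecomposition of $G_{\overline{B}(0,R)}$ as above), with $r_\Lambda=r+l_M$,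 the difference $\rho_{\overline{B}(0,R)}-\chi_{\overline{B}(0,R)}$ belongs to $\ell^1(\Lambda)$ and $$C_1\,\#\partial^{r_\Lambda}_\Lambda \overline{B}(0,R)\;\le\;\big\|\rho_{\overline{B}(0,R)}-\chi_{\overline{B}(0,R)}\big\|_{\ell^1(\Lambda)}\;\le\;C_2\,\#\partial^{r_\Lambda}_\Lambda \overline{B}(0,R).$$ -/

import Mathlib

open MeasureTheory
open scoped Pointwise

noncomputable section

/-- The signal space `L²(ℝᵈ)`. -/
abbrev SignalSpace (d : ℕ) : Type :=
  Lp ℂ 2 (volume : Measure (EuclideanSpace ℝ (Fin d)))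

/-- Time-frequency space `ℝ²ᵈ` with its Euclidean norm. The first `d` coordinates are the time
variable `x`, the last `d` coordinates the frequency variable `ω` of a point `z = (x, ω)`. -/
abbrev PhaseSpace (d : ℕ) : Type := EuclideanSpace ℝ (Fin d ⊕ Fin d)

/-- The time component `x` of `z = (x, ω)`. -/
def PhaseSpace.time {d : ℕ} (z : PhaseSpace d) : EuclideanSpace ℝ (Fin d) :=
  WithLp.toLp 2 fun i => z (Sum.inl i)

/-- The frequency component `ω` of `z = (x, ω)`. -/
def PhaseSpace.freq {d : ℕ} (z : PhaseSpace d) : EuclideanSpace ℝ (Fin d) :=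
  WithLp.toLp 2 fun i => z (Sum.inr i)

/-- The time-frequency shift of a function, `t ↦ e^{2 π i ω · t} f (t - x)`. -/
def tfShiftFun {d : ℕ} (z : PhaseSpace d) (f : EuclideanSpace ℝ (Fin d) → ℂ) :
    EuclideanSpace ℝ (Fin d) → ℂ :=
  fun t => Complex.exp (2 * Real.pi * Complex.I * ((inner ℝ z.freq t : ℝ) : ℂ)) * f (t - z.time)

theorem memLp_tfShiftFun {d : ℕ} (z : PhaseSpace d) (f : SignalSpace d) :
    MemLp (tfShiftFun z f) 2 (volume : Measure (EuclideanSpace ℝ (Fin d))) := by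
  have hf : MemLp (fun t => (f : EuclideanSpace ℝ (Fin d) → ℂ) (t - z.time)) 2 volume :=
    (Lp.memLp f).comp_measurePreserving (measurePreserving_sub_right volume z.time)
  have hc : Continuous fun t : EuclideanSpace ℝ (Fin d) =>
      Complex.exp (2 * Real.pi * Complex.I * ((inner ℝ z.freq t : ℝ) : ℂ)) := by
    fun_prop
  refine hf.congr_norm (hc.aestronglyMeasurable.mul hf.aestronglyMeasurable) ?_
  refine Filter.Eventually.of_forall fun t => ?_
  have h : 2 * (Real.pi : ℂ) * Complex.I * ((inner ℝ z.freq t : ℝ) : ℂ)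
      = ((2 * Real.pi * inner ℝ z.freq t : ℝ) : ℂ) * Complex.I := by
    push_cast
    ring
  simp only [tfShiftFun, norm_mul]
  rw [h, Complex.norm_exp_ofReal_mul_I, one_mul]

/-- The time-frequency shift `π(z)` on `L²(ℝᵈ)`. -/
def tfShift {d : ℕ} (z : PhaseSpace d) (f : SignalSpace d) : SignalSpace d :=
  (memLp_tfShiftFun z f).toLp (tfShiftFun z f)

/-- The short-time Fourier transform `V_g f (z) = ⟨f, π(z) g⟩`. (The inner product of Mathlib is
conjugate-linear in its first argument.) -/
def stft {d : ℕ} (g f : SignalSpace d) (z : PhaseSpace d) : ℂ :=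
  inner ℂ (tfShift z g) f

/-- `(g, Λ)` induces a Gabor frame with frame bounds `A, B > 0`. -/
def IsGaborFrame {d : ℕ} (g : SignalSpace d) (L : Submodule ℤ (PhaseSpace d)) (A B : ℝ) : Prop :=
  0 < A ∧ 0 < B ∧ ∀ f : SignalSpace d,
    Summable (fun l : L => ‖stft g f l‖ ^ 2) ∧
      A * ‖f‖ ^ 2 ≤ ∑' l : L, ‖stft g f l‖ ^ 2 ∧
      ∑' l : L, ‖stft g f l‖ ^ 2 ≤ B * ‖f‖ ^ 2

/-- `g` belongs to `M*_Λ(ℝᵈ)`, i.e. `∑_{λ ∈ Λ} |λ| |V_g g(λ)|² < ∞`. -/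
def MemMStar {d : ℕ} (L : Submodule ℤ (PhaseSpace d)) (g : SignalSpace d) : Prop :=
  Summable fun l : L => ‖(l : PhaseSpace d)‖ * ‖stft g g l‖ ^ 2

/-- The Gabor multiplier `f ↦ ∑_{λ ∈ Λ} χ_Ω(λ) V_g f(λ) π(λ) g` with mask `Ω`. -/
def gaborMultiplier {d : ℕ} (g : SignalSpace d) (L : Submodule ℤ (PhaseSpace d))
    (Ω : Set (PhaseSpace d)) (f : SignalSpace d) : SignalSpace d :=
  ∑' l : L, Ω.indicator (fun z => stft g f z) (l : PhaseSpace d) • tfShift (l : PhaseSpace d) g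

/-- `T = ∑ₖ μₖ (hₖ ⊗ hₖ)` with an orthonormal basis `(hₖ)` of `L²(ℝᵈ)` and with the eigenvalues in
non-increasing order, where `(hₖ ⊗ hₖ) f = ⟨f, hₖ⟩ hₖ`. Indices start at `0`. -/
def IsEigendecomposition {d : ℕ} (T : SignalSpace d → SignalSpace d) (μ : ℕ → ℝ)
    (h : HilbertBasis ℕ ℂ (SignalSpace d)) : Prop :=
  Antitone μ ∧ ∀ f : SignalSpace d, HasSum (fun k => ((μ k : ℂ) * inner ℂ (h k) f) • h k) (T f)

/-- The number `A_Ω = ⌈#(Ω ∩ Λ) ‖g‖² / B⌉` of eigenfunctions in the accumulated spectrogram. -/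
def accCount {d : ℕ} (g : SignalSpace d) (L : Submodule ℤ (PhaseSpace d)) (B : ℝ)
    (Ω : Set (PhaseSpace d)) : ℕ :=
  ⌈((Ω ∩ (L : Set (PhaseSpace d))).ncard : ℝ) * ‖g‖ ^ 2 / B⌉₊

/-- The accumulated spectrogram `ρ_Ω(z) = ‖g‖⁻² ∑_{k ≤ A_Ω} |V_g hₖ(z)|²` formed with the
eigenfunctions `(hₖ)`, for upper frame bound `B`. -/
def accSpectrogram {d : ℕ} (g : SignalSpace d) (L : Submodule ℤ (PhaseSpace d)) (B : ℝ)
    (Ω : Set (PhaseSpace d)) (h : ℕ → SignalSpace d) (z : PhaseSpace d) : ℝ :=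
  1 / ‖g‖ ^ 2 * ∑ k ∈ Finset.range (accCount g L B Ω), ‖stft g (h k) z‖ ^ 2

/-- The lattice boundary `∂^r_Λ Ω = Λ ∩ (∂Ω + B(0, r))`. -/
def latticeBoundary {d : ℕ} (L : Submodule ℤ (PhaseSpace d)) (r : ℝ) (Ω : Set (PhaseSpace d)) :
    Set (PhaseSpace d) :=
  (L : Set (PhaseSpace d)) ∩ (frontier Ω + Metric.ball 0 r)

end

/-! The vectors π(λ)g form a Parseval frame of equal norms, and G_Ω is its restriction to the finite
index set S = Ω ∩ Λ. Since 0 ≤ ρ_Ω ≤ 1, the ℓ¹ error has no cancellation and equals ‖g‖⁻²(A + T - 2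
∑_{k<A} μ_k), where T is the trace and A = ⌈T⌉ (`hasSum_abs_accumulated_sub_indicator`). For a
decreasing spectrum in [0,1] this bracket lies between D and 2D + 1, with D = tr(G_Ω - G_Ω²)
(`accumulated_defect_bounds`).

By the frame identity and covariance, D is the sum of |V_g g(λ - λ')|² over λ' in S and λ outside S
(`hasSum_eigenvalue_mul_one_sub`). For a ball, D is comparable to the number of boundary lattice
points. From below, each such point has a partner across the sphere at distance less than r + 3 diam
F, where |V_g g|² ≥ δ > 0 (`interaction_lower_bound`). From above, each pair separated by the sphere
is charged to a boundary point, and the decay of V_g g makes the charges summable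
(`interaction_upper_bound`). The boundary is never empty, so the extra 1 is absorbed. -/

/-! ### Decreasing sequences in [0,1]. -/

theorem accumulated_defect_bounds {μ : ℕ → ℝ} (hμ : Antitone μ) (h0 : ∀ k, 0 ≤ μ k)
    (h1 : ∀ k, μ k ≤ 1) {T D : ℝ} (hT : HasSum μ T)
    (hD : HasSum (fun k => μ k * (1 - μ k)) D) :
    D ≤ (⌈T⌉₊ : ℝ) + T - 2 * ∑ k ∈ Finset.range ⌈T⌉₊, μ k ∧
      (⌈T⌉₊ : ℝ) + T - 2 * ∑ k ∈ Finset.range ⌈T⌉₊, μ k ≤ 2 * D + 1 := by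
  have hT0 : 0 ≤ T := hT.nonneg h0
  have hA : T ≤ (⌈T⌉₊ : ℝ) := Nat.le_ceil T
  have hA' : (⌈T⌉₊ : ℝ) < T + 1 := Nat.ceil_lt_add_one hT0
  generalize ⌈T⌉₊ = A at *
  have tT := (hasSum_nat_add_iff' A).2 hT
  have tD := (hasSum_nat_add_iff' A).2 hD
  set P := ∑ k ∈ Finset.range A, μ k with hP
  set D₀ := ∑ k ∈ Finset.range A, μ k * (1 - μ k) with hD₀
  have hsum : ∑ k ∈ Finset.range A, (1 - μ k) = A - P := by simp [hP]
  have e1 : D₀ ≤ A - P := by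
    rw [← hsum]
    exact Finset.sum_le_sum fun k _ => mul_le_of_le_one_left (by linarith [h1 k]) (h1 k)
  have e2 : D - D₀ ≤ T - P :=
    hasSum_le (fun k => mul_le_of_le_one_right (h0 _) (by linarith [h0 (k + A)])) tD tT
  -- With indices from 0, `μ A` is the first eigenvalue left out: a lower bound for those kept, an
  -- upper bound for the rest.
  have e3 : μ A * (A - P) ≤ D₀ := by
    rw [← hsum, Finset.mul_sum]
    refine Finset.sum_le_sum fun k hk => ?_
    exact mul_le_mul_of_nonneg_right (hμ (Finset.mem_range.1 hk).le) (by linarith [h1 k])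
  have e4 : (1 - μ A) * (T - P) ≤ D - D₀ := by
    refine hasSum_le (fun k => ?_) (tT.mul_left (1 - μ A)) tD
    rw [mul_comm]
    exact mul_le_mul_of_nonneg_left (by linarith [hμ (Nat.le_add_left A k)]) (h0 _)
  -- Adding `e3` and `e4` now gives T - P ≤ D, and the bracket is 2(T - P) + (A - T) with A - T < 1.
  have e5 : μ A * (T - P) ≤ μ A * (A - P) := mul_le_mul_of_nonneg_left (by linarith) (h0 A)
  constructor <;> linarith

/-! ### Multipliers of Parseval frames. -/

section Frame

variable {ι H : Type*} [NormedAddCommGroup H] [InnerProductSpace ℂ H]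

local notation "⟪" x ", " y "⟫" => inner ℂ x y

theorem inner_frameMultiplier (e : ι → H) (S : Finset ι) (f : H) :
    ⟪f, ∑ i ∈ S, ⟪e i, f⟫ • e i⟫ = ((∑ i ∈ S, ‖⟪e i, f⟫‖ ^ 2 : ℝ) : ℂ) := by
  rw [inner_sum]
  push_cast
  refine Finset.sum_congr rfl fun i _ => ?_
  rw [inner_smul_right, ← inner_conj_symm f (e i), Complex.mul_conj']

theorem hasSum_norm_inner_sq (b : HilbertBasis ℕ ℂ H) (x : H) :
    HasSum (fun k => ‖⟪x, b k⟫‖ ^ 2) (‖x‖ ^ 2) := by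
  have h := b.hasSum_inner_mul_inner x x
  rw [inner_self_eq_norm_sq_to_K] at h
  rw [← Complex.hasSum_ofReal]
  convert! h using 1
  · ext k
    rw [← inner_conj_symm (b k) x, Complex.mul_conj']
    push_cast
    rfl
  · push_cast
    rfl

theorem eigenvalue_eq_sum {e : ι → H} {S : Finset ι} {μ : ℕ → ℝ} {b : HilbertBasis ℕ ℂ H}
    (hdec : ∀ f : H, HasSum (fun k => ((μ k : ℂ) * ⟪b k, f⟫) • b k) (∑ i ∈ S, ⟪e i, f⟫ • e i))
    (k : ℕ) : μ k = ∑ i ∈ S, ‖⟪e i, b k⟫‖ ^ 2 := by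
  have h1 : HasSum (fun j => ((μ j : ℂ) * ⟪b j, b k⟫) • b j) ((μ k : ℂ) • b k) := by
    have := hasSum_single (f := fun j => ((μ j : ℂ) * ⟪b j, b k⟫) • b j) k
      (fun j hj => by simp [b.orthonormal.2 hj])
    have hk : ⟪b k, b k⟫ = 1 := by
      rw [inner_self_eq_norm_sq_to_K, b.orthonormal.1 k]; simp
    simpa only [hk, mul_one] using this
  have h2 := (hdec (b k)).unique h1
  have h3 := inner_frameMultiplier e S (b k)
  rw [h2, inner_smul_right, inner_self_eq_norm_sq_to_K, b.orthonormal.1 k] at h3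
  have : (μ k : ℂ) = ((∑ i ∈ S, ‖⟪e i, b k⟫‖ ^ 2 : ℝ) : ℂ) := by simpa using h3
  exact_mod_cast this

theorem hasSum_eigenvalue_mul {e : ι → H} {S : Finset ι} {μ : ℕ → ℝ} {b : HilbertBasis ℕ ℂ H}
    (hdec : ∀ f : H, HasSum (fun k => ((μ k : ℂ) * ⟪b k, f⟫) • b k) (∑ i ∈ S, ⟪e i, f⟫ • e i))
    (f : H) : HasSum (fun k => μ k * ‖⟪f, b k⟫‖ ^ 2) (∑ i ∈ S, ‖⟪e i, f⟫‖ ^ 2) := by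
  have h := (hdec f).mapL (innerSL ℂ f)
  simp only [innerSL_apply_apply] at h
  rw [inner_frameMultiplier] at h
  rw [← Complex.hasSum_ofReal]
  convert! h using 1
  ext k
  rw [inner_smul_right, mul_assoc, ← inner_conj_symm (b k) f, Complex.conj_mul']
  push_cast
  rw [norm_inner_symm]

/-- The `ℓ¹` distance of the accumulated spectrogram of a Parseval frame to the indicator function
of the mask. -/
theorem hasSum_abs_accumulated_sub_indicator {e : ι → H} {S : Finset ι} {μ : ℕ → ℝ}
    {b : HilbertBasis ℕ ℂ H} {c : ℝ} (hc : 0 < c) (hec : ∀ i, ‖e i‖ ^ 2 = c)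
    (hframe : ∀ f : H, HasSum (fun i => ‖⟪e i, f⟫‖ ^ 2) (‖f‖ ^ 2))
    (hdec : ∀ f : H, HasSum (fun k => ((μ k : ℂ) * ⟪b k, f⟫) • b k) (∑ i ∈ S, ⟪e i, f⟫ • e i))
    (A : ℕ) :
    HasSum (fun i => |1 / c * ∑ k ∈ Finset.range A, ‖⟪e i, b k⟫‖ ^ 2 -
        (S : Set ι).indicator (fun _ => (1 : ℝ)) i|)
      (1 / c * (A + S.card * c - 2 * ∑ k ∈ Finset.range A, μ k)) := by
  classical
  set ρ : ι → ℝ := fun i => 1 / c * ∑ k ∈ Finset.range A, ‖⟪e i, b k⟫‖ ^ 2 with hρ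
  have hρ0 : ∀ i, 0 ≤ ρ i := fun i => by positivity
  have hρ1 : ∀ i, ρ i ≤ 1 := fun i => by
    have := sum_le_hasSum (Finset.range A) (fun k _ => by positivity) (hasSum_norm_inner_sq b (e i))
    rw [hec] at this
    rw [hρ]
    simp only
    rw [one_div, inv_mul_le_iff₀ hc]
    simpa using this
  have s1 : HasSum ρ (1 / c * A) := by
    refine HasSum.mul_left _ ?_
    have := hasSum_sum (s := Finset.range A) fun k _ => hframe (b k)
    simpa [b.orthonormal.1] using this
  -- Because 0 ≤ ρ ≤ 1, |ρ - χ_S| = ρ + χ_S (1 - 2ρ); only the second term depends on the spectrum.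
  have s2 : HasSum (fun i => (S : Set ι).indicator (fun i => 1 - 2 * ρ i) i)
      (∑ i ∈ S, (1 - 2 * ρ i)) := by
    have := hasSum_sum_of_ne_finset_zero (L := .unconditional ι) (f := (S : Set ι).indicator (fun i => 1 - 2 * ρ i)) (s := S)
      (fun i hi => Set.indicator_of_notMem (fun h => hi (Finset.mem_coe.1 h)) _)
    convert! this using 1
    exact Finset.sum_congr rfl fun i hi => (Set.indicator_of_mem (Finset.mem_coe.2 hi) (fun i => 1 - 2 * ρ i)).symm
  have hsum : ∑ i ∈ S, ρ i = 1 / c * ∑ k ∈ Finset.range A, μ k := by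
    simp only [hρ, ← Finset.mul_sum]
    rw [Finset.sum_comm]
    simp only [← eigenvalue_eq_sum hdec]
  convert! s1.add s2 using 1
  · ext i
    by_cases hi : i ∈ (S : Set ι)
    · simp only [Set.indicator_of_mem hi]
      rw [abs_of_nonpos (by linarith [hρ1 i])]
      ring
    · simp only [Set.indicator_of_notMem hi]
      rw [sub_zero, add_zero, abs_of_nonneg (hρ0 i)]
  · rw [Finset.sum_sub_distrib, ← Finset.mul_sum, hsum]
    simp
    field_simp
    ring

/-- The trace of `T - T²` for the frame multiplier `T` with mask `S`, expressed by the interaction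
of the mask with its complement. -/
theorem hasSum_eigenvalue_mul_one_sub {e : ι → H} {S : Finset ι} {μ : ℕ → ℝ}
    {b : HilbertBasis ℕ ℂ H}
    (hframe : ∀ f : H, HasSum (fun i => ‖⟪e i, f⟫‖ ^ 2) (‖f‖ ^ 2))
    (hdec : ∀ f : H, HasSum (fun k => ((μ k : ℂ) * ⟪b k, f⟫) • b k) (∑ i ∈ S, ⟪e i, f⟫ • e i)) :
    HasSum (fun k => μ k * (1 - μ k))
      (∑ i ∈ S, ∑' j, (S : Set ι)ᶜ.indicator (fun j => ‖⟪e j, e i⟫‖ ^ 2) j) := by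
  classical
  -- tr(T - T²) is the sum over i in S of ‖e i‖² - ⟨T e i, e i⟩; the frame identity for `e i` leaves
  -- only the indices off S.
  have h1 := hasSum_sum (s := S) fun i _ =>
    (hasSum_norm_inner_sq b (e i)).sub (hasSum_eigenvalue_mul hdec (e i))
  convert! h1 using 1
  · ext k
    rw [Finset.sum_sub_distrib, ← Finset.mul_sum, ← eigenvalue_eq_sum hdec]
    ring
  · refine Finset.sum_congr rfl fun i _ => ?_
    have h2 := (hframe (e i)).summable.sum_add_tsum_compl (s := S)
    rw [(hframe (e i)).tsum_eq] at h2
    rw [← tsum_subtype, ← h2]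
    ring

theorem accumulated_l1_bounds {e : ι → H} {S : Finset ι} {μ : ℕ → ℝ}
    {b : HilbertBasis ℕ ℂ H} {c : ℝ} (hμ : Antitone μ) (hec : ∀ i, ‖e i‖ ^ 2 = c)
    (hframe : ∀ f : H, HasSum (fun i => ‖⟪e i, f⟫‖ ^ 2) (‖f‖ ^ 2))
    (hdec : ∀ f : H, HasSum (fun k => ((μ k : ℂ) * ⟪b k, f⟫) • b k) (∑ i ∈ S, ⟪e i, f⟫ • e i)) :
    let D := ∑ i ∈ S, ∑' j, (S : Set ι)ᶜ.indicator (fun j => ‖⟪e j, e i⟫‖ ^ 2) j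
    let E := (⌈(S.card : ℝ) * c⌉₊ : ℝ) + S.card * c -
      2 * ∑ k ∈ Finset.range ⌈(S.card : ℝ) * c⌉₊, μ k
    D ≤ E ∧ E ≤ 2 * D + 1 := by
  have hev := eigenvalue_eq_sum hdec
  refine accumulated_defect_bounds hμ (fun k => ?_) (fun k => ?_) ?_
    (hasSum_eigenvalue_mul_one_sub hframe hdec)
  · rw [hev]
    positivity
  · rw [hev]
    have := sum_le_hasSum S (fun k _ => by positivity) (hframe (b k))
    simpa [b.orthonormal.1] using this
  · have := hasSum_sum (s := S) fun i _ => hasSum_norm_inner_sq b (e i)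
    simpa [hec, ← hev] using this

end Frame

/-! ### Interaction of a finite set with its complement. -/

section Interaction

variable {G : Type*} [AddCommGroup G]

/-- Points of B inside S each contribute δ to a separate row of the double sum, those outside to a
separate column. Each family alone is bounded by the whole sum, hence the factor 1/2. -/
theorem interaction_lower_bound {w : G → ℝ} (hw : ∀ z, 0 ≤ w z) (hws : Summable w)
    {S B : Finset G} {δ : ℝ}
    (hin : ∀ i ∈ B, i ∈ S → ∃ j ∉ S, δ ≤ w (j - i))
    (hout : ∀ j ∈ B, j ∉ S → ∃ i ∈ S, δ ≤ w (j - i)) :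
    δ / 2 * B.card ≤ ∑ i ∈ S, ∑' j, (S : Set G)ᶜ.indicator (fun j => w (j - i)) j := by
  classical
  have hsum : ∀ i, Summable fun j => (S : Set G)ᶜ.indicator (fun j => w (j - i)) j := fun i =>
    ((Equiv.subRight i).summable_iff.2 hws).indicator _
  have hnn : ∀ i j, 0 ≤ (S : Set G)ᶜ.indicator (fun j => w (j - i)) j := fun i j =>
    Set.indicator_nonneg (fun _ _ => hw _) _
  have h1 : δ * (B.filter (· ∈ S)).card ≤
      ∑ i ∈ S, ∑' j, (S : Set G)ᶜ.indicator (fun j => w (j - i)) j := by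
    calc δ * (B.filter (· ∈ S)).card = ∑ i ∈ B.filter (· ∈ S), δ := by simp [mul_comm]
      _ ≤ ∑ i ∈ B.filter (· ∈ S), ∑' j, (S : Set G)ᶜ.indicator (fun j => w (j - i)) j := by
          refine Finset.sum_le_sum fun i hi => ?_
          obtain ⟨hiB, hiS⟩ := Finset.mem_filter.1 hi
          obtain ⟨j, hj, hd⟩ := hin i hiB hiS
          refine hd.trans ?_
          have := (hsum i).le_tsum j fun k _ => hnn i k
          rwa [Set.indicator_of_mem (by simpa using hj)] at this
      _ ≤ _ := Finset.sum_le_sum_of_subset_of_nonneg (fun i hi => (Finset.mem_filter.1 hi).2)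
          fun i _ _ => tsum_nonneg (hnn i)
  have h2 : δ * (B.filter (· ∉ S)).card ≤
      ∑ i ∈ S, ∑' j, (S : Set G)ᶜ.indicator (fun j => w (j - i)) j := by
    rw [← Summable.tsum_finsetSum fun i _ => hsum i]
    calc δ * (B.filter (· ∉ S)).card = ∑ i ∈ B.filter (· ∉ S), δ := by simp [mul_comm]
      _ ≤ ∑ j ∈ B.filter (· ∉ S), ∑ i ∈ S, (S : Set G)ᶜ.indicator (fun j => w (j - i)) j := by
          refine Finset.sum_le_sum fun j hj => ?_
          obtain ⟨hjB, hjS⟩ := Finset.mem_filter.1 hj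
          obtain ⟨i, hi, hd⟩ := hout j hjB hjS
          refine hd.trans ?_
          have := Finset.single_le_sum (f := fun i => (S : Set G)ᶜ.indicator (fun j => w (j - i)) j)
            (fun k _ => hnn k j) hi
          rwa [Set.indicator_of_mem (by simpa using hjS)] at this
      _ ≤ _ := (summable_sum fun i _ => hsum i).sum_le_tsum _
          fun j _ => Finset.sum_nonneg fun i _ => hnn i j
  have h3 : ((B.filter (· ∈ S)).card : ℝ) + (B.filter (· ∉ S)).card = B.card := by
    exact_mod_cast Finset.card_filter_add_card_filter_not (s := B) (· ∈ S)
  rw [← h3]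
  linarith

/-- The product form of the bound decouples the sums: over i, then over j, each costs at most ∑ q,
leaving one term per ν. -/
theorem interaction_upper_bound {w q : G → ℝ} (hws : Summable w)
    (hq : ∀ z, 0 ≤ q z) (hqs : Summable q) {S B : Finset G} {K : ℝ} (hK : 0 ≤ K)
    (h : ∀ i ∈ S, ∀ j ∉ S, ∃ ν ∈ B, w (j - i) ≤ K * (q (j - i) * q (j - ν))) :
    ∑ i ∈ S, ∑' j, (S : Set G)ᶜ.indicator (fun j => w (j - i)) j ≤
      K * (∑' z, q z) ^ 2 * B.card := by
  classical
  have hsum : ∀ i, Summable fun j => (S : Set G)ᶜ.indicator (fun j => w (j - i)) j := fun i =>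
    ((Equiv.subRight i).summable_iff.2 hws).indicator _
  have hqi : ∀ i, Summable fun j => q (j - i) := fun i => (Equiv.subRight i).summable_iff.2 hqs
  have hrow : ∀ j, ∑ i ∈ S, q (j - i) ≤ ∑' z, q z := fun j => by
    rw [← (Equiv.subLeft j).tsum_eq q]
    exact Summable.sum_le_tsum _ (fun _ _ => hq _) ((Equiv.subLeft j).summable_iff.2 hqs)
  have hW : 0 ≤ ∑' z, q z := tsum_nonneg hq
  have hB : Summable fun j => ∑ ν ∈ B, K * ((∑' z, q z) * q (j - ν)) :=
    summable_sum fun ν _ => ((hqi ν).mul_left _).mul_left _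
  rw [← Summable.tsum_finsetSum fun i _ => hsum i]
  calc ∑' j, ∑ i ∈ S, (S : Set G)ᶜ.indicator (fun j => w (j - i)) j
      ≤ ∑' j, ∑ ν ∈ B, K * ((∑' z, q z) * q (j - ν)) := by
        refine Summable.tsum_le_tsum (fun j => ?_) (summable_sum fun i _ => hsum i) hB
        by_cases hj : j ∈ S
        · have : ∑ i ∈ S, (S : Set G)ᶜ.indicator (fun j => w (j - i)) j = 0 :=
            Finset.sum_eq_zero fun i _ => Set.indicator_of_notMem (by simpa using hj) _
          rw [this]
          exact Finset.sum_nonneg fun ν _ => mul_nonneg hK (mul_nonneg hW (hq _))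
        · calc ∑ i ∈ S, (S : Set G)ᶜ.indicator (fun j => w (j - i)) j
              ≤ ∑ i ∈ S, ∑ ν ∈ B, K * (q (j - i) * q (j - ν)) := by
                refine Finset.sum_le_sum fun i hi => ?_
                rw [Set.indicator_of_mem (by simpa using hj)]
                obtain ⟨ν, hν, hle⟩ := h i hi j hj
                exact hle.trans (Finset.single_le_sum
                  (f := fun ν => K * (q (j - i) * q (j - ν)))
                  (fun ν _ => mul_nonneg hK (mul_nonneg (hq _) (hq _))) hν)
            _ = ∑ ν ∈ B, K * ((∑ i ∈ S, q (j - i)) * q (j - ν)) := by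
                rw [Finset.sum_comm]
                refine Finset.sum_congr rfl fun ν _ => ?_
                rw [← Finset.mul_sum, ← Finset.sum_mul]
            _ ≤ _ := by
                refine Finset.sum_le_sum fun ν _ => ?_
                exact mul_le_mul_of_nonneg_left
                  (mul_le_mul_of_nonneg_right (hrow j) (hq _)) hK
    _ = ∑ ν ∈ B, K * ((∑' z, q z) * ∑' z, q z) := by
        rw [Summable.tsum_finsetSum fun ν _ => ((hqi ν).mul_left _).mul_left _]
        refine Finset.sum_congr rfl fun ν _ => ?_
        rw [tsum_mul_left, tsum_mul_left, ← (Equiv.subRight ν).tsum_eq q]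
        rfl
    _ = K * (∑' z, q z) ^ 2 * B.card := by
        simp
        ring

end Interaction

/-! ### Lattice points near a sphere. -/

section Lattice

theorem summable_one_add_norm_rpow {E : Type*} [NormedAddCommGroup E] [NormedSpace ℝ E]
    [FiniteDimensional ℝ E] (L : Submodule ℤ E) [DiscreteTopology L] [IsZLattice ℝ L] {s : ℝ}
    (hs : (Module.finrank ℝ E : ℝ) < s) :
    Summable fun l : L => (1 + ‖(l : E)‖) ^ (-s) := by
  have hs0 : 0 ≤ s := (Nat.cast_nonneg _).trans hs.le
  have h := ZLattice.summable_norm_rpow L (-s) (by rw [ZLattice.rank ℝ L]; linarith)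
  refine h.of_norm_bounded_eventually ?_
  have hfin : Set.Finite {l : L | l = 0} := Set.finite_singleton 0
  filter_upwards [hfin.compl_mem_cofinite] with l hl
  have hl0 : 0 < ‖(l : E)‖ := norm_pos_iff.2 fun h => hl (by simpa using h)
  rw [Real.norm_of_nonneg (by positivity)]
  exact Real.rpow_le_rpow_of_nonpos hl0 (by simp) (by linarith)

/-- Every point lies within the diameter of a bounded fundamental domain (up to an arbitrarily
small error) of the lattice. -/
theorem exists_norm_sub_lt_of_isAddFundamentalDomain {E : Type*}
    [NormedAddCommGroup E] [MeasurableSpace E] {L : Submodule ℤ E} {F : Set E}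
    {ν : Measure E} [ν.IsOpenPosMeasure] (hF : IsAddFundamentalDomain L F ν)
    (hFb : Bornology.IsBounded F) (q : E) {ρ : ℝ} (hρ : Metric.diam F < ρ) :
    ∃ l : L, ‖(l : E) - q‖ < ρ := by
  have hcov := hF.ae_covers
  obtain ⟨x₀, l₀, hx₀⟩ := hcov.exists
  have hdense := Measure.dense_of_ae hcov
  -- The translates of F cover only almost everywhere, so q is reached through a dense set; this is
  -- why ρ must exceed the diameter strictly.
  obtain ⟨y, ⟨l, hl⟩, hy⟩ := hdense.exists_dist_lt (q + ((l₀ : E) + x₀)) (sub_pos.2 hρ)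
  have hx₀' : (l₀ : E) + x₀ ∈ F := hx₀
  have hl' : (l : E) + y ∈ F := hl
  refine ⟨-l, ?_⟩
  have hd := Metric.dist_le_diam_of_mem hFb hx₀' hl'
  rw [dist_eq_norm] at hd hy
  have : ((-l : L) : E) - q = (((l₀ : E) + x₀) - ((l : E) + y)) - (q + ((l₀ : E) + x₀) - y) := by
    push_cast
    abel
  rw [this]
  exact (norm_sub_le _ _).trans_lt (by linarith)

/-- Radial projection of y: its distance to y is ‖y‖ - R ≤ ‖y‖ - ‖x‖. -/
theorem exists_sphere_norm_sub_le {E : Type*} [NormedAddCommGroup E]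
    [NormedSpace ℝ E] {x y : E} {R : ℝ} (hR : 0 < R) (hx : ‖x‖ ≤ R) (hy : R < ‖y‖) :
    ∃ p : E, ‖p‖ = R ∧ ‖y - p‖ ≤ ‖y - x‖ := by
  have hy0 : 0 < ‖y‖ := hR.trans hy
  refine ⟨(R / ‖y‖) • y, ?_, ?_⟩
  · rw [norm_smul, Real.norm_of_nonneg (by positivity)]
    field_simp
  · have h1 : y - (R / ‖y‖) • y = (1 - R / ‖y‖) • y := by rw [sub_smul, one_smul]
    have h2 : R / ‖y‖ ≤ 1 := (div_le_one hy0).2 hy.le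
    rw [h1, norm_smul, Real.norm_of_nonneg (by linarith), sub_mul, one_mul,
      div_mul_cancel₀ _ hy0.ne']
    have := norm_sub_norm_le y x
    linarith

theorem finite_lattice_closedBall {E : Type*} [NormedAddCommGroup E] [NormedSpace ℝ E]
    [FiniteDimensional ℝ E] (L : Submodule ℤ E) [DiscreteTopology L] (ρ : ℝ) :
    {l : L | ‖(l : E)‖ ≤ ρ}.Finite := by
  have H : IsClosed (X := E) L := @AddSubgroup.isClosed_of_discrete _ _ _ _ _
    L.toAddSubgroup (inferInstanceAs (DiscreteTopology L))
  have := Metric.finite_isBounded_inter_isClosed (s := (L : Set E)) DiscreteTopology.isDiscrete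
    (Metric.isBounded_closedBall (x := (0 : E)) (r := ρ)) H
  refine (this.preimage Subtype.val_injective.injOn).subset fun l hl => ?_
  exact ⟨by simpa using hl, l.2⟩

/-- Push p radially by D + ε, then take a lattice point closer than D + ε: it cannot return across
the sphere. The two moves account for the 2 diam F. -/
theorem exists_lattice_norm_lt_near_sphere {E : Type*} [NormedAddCommGroup E] [NormedSpace ℝ E]
    [MeasurableSpace E] {L : Submodule ℤ E} {F : Set E}
    {ν : Measure E} [ν.IsOpenPosMeasure] (hF : IsAddFundamentalDomain L F ν)
    (hFb : Bornology.IsBounded F) {R τ : ℝ} (hR : 0 < R) {x p : E} (hp : ‖p‖ = R)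
    (hxp : ‖x - p‖ < τ) :
    (∃ l : L, R < ‖(l : E)‖ ∧ ‖(l : E) - x‖ < τ + 2 * Metric.diam F) ∧
      ∃ l : L, ‖(l : E)‖ ≤ R ∧ ‖x - (l : E)‖ < τ + 2 * Metric.diam F := by
  set D := Metric.diam F with hD
  have hD0 : 0 ≤ D := Metric.diam_nonneg
  obtain ⟨ε, hε, hε'⟩ : ∃ ε, 0 < ε ∧ ‖x - p‖ + 2 * ε < τ :=
    ⟨(τ - ‖x - p‖) / 3, by linarith, by linarith⟩
  constructor
  · set q : E := (1 + (D + ε) / R) • p with hq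
    have hqn : ‖q‖ = R + (D + ε) := by
      rw [hq, norm_smul, Real.norm_of_nonneg (by positivity), hp]
      field_simp
    have hqp : ‖q - p‖ = D + ε := by
      have : q - p = ((D + ε) / R) • p := by rw [hq, add_smul, one_smul, add_sub_cancel_left]
      rw [this, norm_smul, Real.norm_of_nonneg (by positivity), hp]
      field_simp
    obtain ⟨l, hl⟩ := exists_norm_sub_lt_of_isAddFundamentalDomain hF hFb q
      (show D < D + ε by linarith)
    refine ⟨l, ?_, ?_⟩
    · have := norm_sub_norm_le q l
      rw [norm_sub_rev] at hl
      linarith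
    · have h1 : (l : E) - x = (l - q) + (q - p) - (x - p) := by abel
      rw [h1]
      have h2 := norm_sub_le ((l - q) + (q - p)) (x - p)
      have h3 := norm_add_le ((l : E) - q) (q - p)
      linarith
  -- In a small ball there is no room to move inwards, and the origin serves instead.
  · by_cases hRD : R ≤ D + ε
    · refine ⟨0, by simpa using hR.le, ?_⟩
      have h1 : x - ((0 : L) : E) = (x - p) + p := by simp
      rw [h1]
      have := norm_add_le (x - p) p
      linarith
    · push Not at hRD
      set q : E := (1 - (D + ε) / R) • p with hq
      have hlt : (D + ε) / R ≤ 1 := (div_le_one hR).2 hRD.le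
      have hqn : ‖q‖ = R - (D + ε) := by
        rw [hq, norm_smul, Real.norm_of_nonneg (by linarith), hp]
        field_simp
      have hqp : ‖p - q‖ = D + ε := by
        have : p - q = ((D + ε) / R) • p := by rw [hq, sub_smul, one_smul, sub_sub_cancel]
        rw [this, norm_smul, Real.norm_of_nonneg (by positivity), hp]
        field_simp
      obtain ⟨l, hl⟩ := exists_norm_sub_lt_of_isAddFundamentalDomain hF hFb q
        (show D < D + ε by linarith)
      refine ⟨l, ?_, ?_⟩
      · have := norm_sub_norm_le (l : E) q
        linarith
      · have h1 : x - (l : E) = (x - p) + (p - q) - (l - q) := by abel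
        rw [h1]
        have h2 := norm_sub_le ((x - p) + (p - q)) ((l : E) - q)
        have h3 := norm_add_le (x - p) (p - q)
        linarith

end Lattice

/-! ### Covariance of the short-time Fourier transform. -/

theorem norm_exp_two_pi_mul_I (x : ℝ) :
    ‖Complex.exp (2 * Real.pi * Complex.I * (x : ℂ))‖ = 1 := by
  rw [show 2 * (Real.pi : ℂ) * Complex.I * (x : ℂ) = ((2 * Real.pi * x : ℝ) : ℂ) * Complex.I by
    push_cast; ring, Complex.norm_exp_ofReal_mul_I]

theorem norm_tfShift {d : ℕ} (z : PhaseSpace d) (f : SignalSpace d) : ‖tfShift z f‖ = ‖f‖ := by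
  have hmp := measurePreserving_sub_right (volume : Measure (EuclideanSpace ℝ (Fin d))) z.time
  have h1 : eLpNorm (tfShiftFun z f) 2 volume = eLpNorm (f : EuclideanSpace ℝ (Fin d) → ℂ) 2 volume := by
    rw [← eLpNorm_comp_measurePreserving (Lp.aestronglyMeasurable f) hmp]
    refine eLpNorm_congr_norm_ae (Filter.Eventually.of_forall fun t => ?_)
    simp only [tfShiftFun, norm_mul, norm_exp_two_pi_mul_I, one_mul, Function.comp]
  rw [tfShift, Lp.norm_toLp, h1, Lp.norm_def]

theorem stft_eq_integral {d : ℕ} (g f : SignalSpace d) (z : PhaseSpace d) :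
    stft g f z = ∫ t, f t * (starRingEnd ℂ) (tfShiftFun z g t) := by
  rw [stft, L2.inner_def]
  refine integral_congr_ae ?_
  filter_upwards [(memLp_tfShiftFun z g).coeFn_toLp] with t ht
  rw [tfShift, ht]
  rfl

theorem norm_stft_tfShift {d : ℕ} (g : SignalSpace d) (z w : PhaseSpace d) :
    ‖stft g (tfShift w g) z‖ = ‖stft g g (z - w)‖ := by
  rw [stft_eq_integral, stft_eq_integral]
  have htime : (z - w).time = z.time - w.time := by ext i; simp [PhaseSpace.time]
  have hfreq : (z - w).freq = z.freq - w.freq := by ext i; simp [PhaseSpace.freq]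
  have h1 : ∫ t, (tfShift w g) t * (starRingEnd ℂ) (tfShiftFun z g t) =
      ∫ t, tfShiftFun w g t * (starRingEnd ℂ) (tfShiftFun z g t) := by
    refine integral_congr_ae ?_
    filter_upwards [(memLp_tfShiftFun w g).coeFn_toLp] with t ht
    rw [tfShift, ht]
  rw [h1, ← integral_add_right_eq_self _ w.time]
  have h2 : ∀ t, tfShiftFun w g (t + w.time) * (starRingEnd ℂ) (tfShiftFun z g (t + w.time)) =
      Complex.exp (2 * Real.pi * Complex.I * ((inner ℝ (w - z).freq w.time : ℝ) : ℂ)) *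
        (g t * (starRingEnd ℂ) (tfShiftFun (z - w) g t)) := by
    intro t
    have h3 : (w - z).freq = w.freq - z.freq := by ext i; simp [PhaseSpace.freq]
    have h4 : t + w.time - z.time = t - (z.time - w.time) := by abel
    simp only [tfShiftFun, add_sub_cancel_right, htime, hfreq, h3, h4, map_mul, ← Complex.exp_conj,
      Complex.conj_ofReal, Complex.conj_I, map_ofNat]
    rw [show ∀ a b c e : ℂ, a * b * (c * e) = (a * c) * (b * e) by intros; ring,
      show ∀ a b c e : ℂ, a * (b * (c * e)) = (a * c) * (b * e) by intros; ring,
      ← Complex.exp_add, ← Complex.exp_add]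
    congr 2
    simp only [inner_sub_left, inner_add_right]
    push_cast
    ring
  simp only [h2]
  rw [integral_const_mul, norm_mul, norm_exp_two_pi_mul_I, one_mul]

/-! ### From frame multipliers to Gabor multipliers. -/

section Mask

variable {d : ℕ} {L : Submodule ℤ (PhaseSpace d)} {Ω : Set (PhaseSpace d)} {S : Finset L}

theorem ncard_inter_eq_card (hS : ∀ l : L, l ∈ S ↔ (l : PhaseSpace d) ∈ Ω) :
    (Ω ∩ (L : Set (PhaseSpace d))).ncard = S.card := by
  have h : Ω ∩ (L : Set (PhaseSpace d)) = Subtype.val '' (S : Set L) := by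
    ext z
    constructor
    · rintro ⟨hz, hzL⟩
      exact ⟨⟨z, hzL⟩, Finset.mem_coe.2 ((hS _).2 hz), rfl⟩
    · rintro ⟨l, hl, rfl⟩
      exact ⟨(hS l).1 (Finset.mem_coe.1 hl), l.2⟩
  rw [h, Set.ncard_image_of_injective _ Subtype.val_injective, Set.ncard_coe_finset]

theorem gaborMultiplier_eq_sum (hS : ∀ l : L, l ∈ S ↔ (l : PhaseSpace d) ∈ Ω)
    (g f : SignalSpace d) :
    gaborMultiplier g L Ω f =
      ∑ l ∈ S, (inner ℂ (tfShift (l : PhaseSpace d) g) f) • tfShift (l : PhaseSpace d) g := by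
  rw [gaborMultiplier, tsum_eq_sum (s := S)]
  · refine Finset.sum_congr rfl fun l hl => ?_
    rw [Set.indicator_of_mem ((hS l).1 hl)]
    rfl
  · intro l hl
    rw [Set.indicator_of_notMem fun h => hl ((hS l).2 h), zero_smul]

theorem coe_indicator_eq (hS : ∀ l : L, l ∈ S ↔ (l : PhaseSpace d) ∈ Ω) (l : L) :
    Ω.indicator (fun _ => (1 : ℝ)) (l : PhaseSpace d) =
      (S : Set L).indicator (fun _ => (1 : ℝ)) l := by
  by_cases h : l ∈ S
  · rw [Set.indicator_of_mem ((hS l).1 h), Set.indicator_of_mem (Finset.mem_coe.2 h)]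
  · rw [Set.indicator_of_notMem fun h' => h ((hS l).2 h'),
      Set.indicator_of_notMem fun h' => h (Finset.mem_coe.1 h')]

theorem IsGaborFrame.hasSum_norm_stft_sq {g : SignalSpace d} (hframe : IsGaborFrame g L 1 1)
    (f : SignalSpace d) : HasSum (fun l : L => ‖stft g f l‖ ^ 2) (‖f‖ ^ 2) := by
  obtain ⟨hs, h1, h2⟩ := hframe.2.2 f
  rw [one_mul] at h1 h2
  exact le_antisymm h2 h1 ▸ hs.hasSum

/-- Comparison of the `ℓ¹` error of the accumulated spectrogram with the interaction of the mask
with its complement. -/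
theorem accSpectrogram_l1_bounds {g : SignalSpace d} (hg : g ≠ 0) (hframe : IsGaborFrame g L 1 1)
    (hS : ∀ l : L, l ∈ S ↔ (l : PhaseSpace d) ∈ Ω) {μ : ℕ → ℝ}
    {h : HilbertBasis ℕ ℂ (SignalSpace d)}
    (hdec : IsEigendecomposition (gaborMultiplier g L Ω) μ h) :
    let D := ∑ i ∈ S, ∑' j : L,
      (S : Set L)ᶜ.indicator (fun j => ‖stft g g ((j - i : L) : PhaseSpace d)‖ ^ 2) j
    Summable (fun l : L => |accSpectrogram g L 1 Ω h l - Ω.indicator (fun _ => (1 : ℝ)) l|) ∧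
      1 / ‖g‖ ^ 2 * D ≤
        ∑' l : L, |accSpectrogram g L 1 Ω h l - Ω.indicator (fun _ => (1 : ℝ)) l| ∧
      ∑' l : L, |accSpectrogram g L 1 Ω h l - Ω.indicator (fun _ => (1 : ℝ)) l| ≤
        1 / ‖g‖ ^ 2 * (2 * D + 1) := by
  intro D
  have hc : 0 < ‖g‖ ^ 2 := by positivity
  have hec : ∀ l : L, ‖tfShift (l : PhaseSpace d) g‖ ^ 2 = ‖g‖ ^ 2 := fun l => by
    rw [norm_tfShift]
  obtain ⟨hμ, hdec⟩ := hdec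
  simp only [gaborMultiplier_eq_sum hS] at hdec
  have hfr := fun f => hframe.hasSum_norm_stft_sq f
  have hE := hasSum_abs_accumulated_sub_indicator hc hec hfr hdec ⌈(S.card : ℝ) * ‖g‖ ^ 2⌉₊
  have hb := accumulated_l1_bounds hμ hec hfr hdec
  have hD : D = ∑ i ∈ S, ∑' j : L, (S : Set L)ᶜ.indicator
      (fun j => ‖inner ℂ (tfShift (j : PhaseSpace d) g) (tfShift (i : PhaseSpace d) g)‖ ^ 2) j := by
    refine Finset.sum_congr rfl fun i _ => ?_
    refine tsum_congr fun j => congrFun (congrArg _ (funext fun j => ?_)) j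
    rw [Submodule.coe_sub, ← norm_stft_tfShift, stft]
  simp only [← hD] at hb
  have hfun : (fun l : L => |accSpectrogram g L 1 Ω h l - Ω.indicator (fun _ => (1 : ℝ)) l|) =
      fun l : L => |1 / ‖g‖ ^ 2 * ∑ k ∈ Finset.range ⌈(S.card : ℝ) * ‖g‖ ^ 2⌉₊,
        ‖(inner ℂ (tfShift (l : PhaseSpace d) g) (h k) : ℂ)‖ ^ 2 -
          (S : Set L).indicator (fun _ => (1 : ℝ)) l| := by
    ext l
    rw [coe_indicator_eq hS, accSpectrogram, accCount, ncard_inter_eq_card hS, div_one]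
    rfl
  rw [hfun, hE.tsum_eq]
  exact ⟨hE.summable, mul_le_mul_of_nonneg_left hb.1 (by positivity),
    mul_le_mul_of_nonneg_left hb.2 (by positivity)⟩

end Mask

/-! ### Balls and the final estimate. -/

theorem mem_latticeBoundary_closedBall_iff {d : ℕ} {L : Submodule ℤ (PhaseSpace d)} {τ R : ℝ}
    (hR : 0 < R) {z : PhaseSpace d} :
    z ∈ latticeBoundary L τ (Metric.closedBall 0 R) ↔
      z ∈ L ∧ ∃ p : PhaseSpace d, ‖p‖ = R ∧ ‖z - p‖ < τ := by
  rw [latticeBoundary, frontier_closedBall _ hR.ne']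
  refine and_congr Iff.rfl ?_
  rw [Set.mem_add]
  constructor
  · rintro ⟨p, hp, y, hy, rfl⟩
    exact ⟨p, by simpa using hp, by simpa using hy⟩
  · rintro ⟨p, hp, hz⟩
    exact ⟨p, by simpa using hp, z - p, by simpa using hz, by abel⟩

/-- Polynomial decay bounds the interaction across a sphere by products of weights centred at points
near the sphere. -/
theorem sq_le_mul_rpow_mul_rpow {v C s a b τ : ℝ} (hC : 0 < C) (hs : 0 ≤ s) (ha : 0 ≤ a)
    (hb : 0 ≤ b) (hτ : 0 ≤ τ) (hv0 : 0 ≤ v) (hv : v ≤ C * (1 + a) ^ (-s)) (hba : b ≤ a + τ) :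
    v ^ 2 ≤ C ^ 2 * (1 + τ) ^ s * ((1 + a) ^ (-s) * (1 + b) ^ (-s)) := by
  -- Peetre's inequality, from 1 + b ≤ (1 + a)(1 + τ).
  have h1 : (1 + a) ^ (-s) ≤ (1 + τ) ^ s * (1 + b) ^ (-s) := by
    rw [Real.rpow_neg (by positivity), Real.rpow_neg (by positivity), ← div_eq_mul_inv,
      ← Real.div_rpow (by positivity) (by positivity), ← Real.inv_rpow (by positivity)]
    refine Real.rpow_le_rpow (by positivity) ?_ hs
    rw [inv_eq_one_div, div_le_div_iff₀ (by positivity) (by positivity)]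
    nlinarith [mul_nonneg ha hτ]
  calc v ^ 2 ≤ (C * (1 + a) ^ (-s)) ^ 2 := pow_le_pow_left₀ hv0 hv 2
    _ = C ^ 2 * ((1 + a) ^ (-s) * (1 + a) ^ (-s)) := by ring
    _ ≤ C ^ 2 * ((1 + a) ^ (-s) * ((1 + τ) ^ s * (1 + b) ^ (-s))) := by gcongr
    _ = _ := by ring

theorem theorem1p3 {d : ℕ} (hd : 0 < d)
    (L : Submodule ℤ (PhaseSpace d)) [DiscreteTopology L] [IsZLattice ℝ L]
    (F : Set (PhaseSpace d)) (hF : IsAddFundamentalDomain L F volume)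
    (hFb : Bornology.IsBounded F)
    (g : SignalSpace d) (hgM : MemMStar L g) (hframe : IsGaborFrame g L 1 1)
    (r : ℝ) (hr : 0 < r)
    (hdecay : ∃ C : ℝ, 0 < C ∧ ∃ s : ℝ, 2 * (d : ℝ) + 1 < s ∧
      ∀ z : PhaseSpace d, ‖stft g g z‖ ≤ C * (1 + ‖z‖) ^ (-s))
    (hnonzero : ∀ l : PhaseSpace d, l ∈ L → l ∈ Metric.ball 0 (r + 3 * Metric.diam F) →
      stft g g l ≠ 0) :
    ∃ C₁ C₂ : ℝ, 0 < C₁ ∧ 0 < C₂ ∧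
      ∀ R : ℝ, 0 < R →
      ∀ (μ : ℕ → ℝ) (h : HilbertBasis ℕ ℂ (SignalSpace d)),
        IsEigendecomposition (gaborMultiplier g L (Metric.closedBall 0 R)) μ h →
        Summable (fun l : L =>
          |accSpectrogram g L 1 (Metric.closedBall 0 R) h l -
            (Metric.closedBall (0 : PhaseSpace d) R).indicator (fun _ => (1 : ℝ)) l|) ∧
        C₁ * ((latticeBoundary L (r + Metric.diam F) (Metric.closedBall 0 R)).ncard : ℝ) ≤
          ∑' l : L, |accSpectrogram g L 1 (Metric.closedBall 0 R) h l -
            (Metric.closedBall (0 : PhaseSpace d) R).indicator (fun _ => (1 : ℝ)) l| ∧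
        ∑' l : L, |accSpectrogram g L 1 (Metric.closedBall 0 R) h l -
            (Metric.closedBall (0 : PhaseSpace d) R).indicator (fun _ => (1 : ℝ)) l| ≤
          C₂ * ((latticeBoundary L (r + Metric.diam F) (Metric.closedBall 0 R)).ncard : ℝ) := by
  obtain ⟨C, hC, s, hs, hdecay⟩ := hdecay
  have : Nonempty (Fin d) := ⟨⟨0, hd⟩⟩
  have hdiam : 0 ≤ Metric.diam F := Metric.diam_nonneg
  set τ : ℝ := r + Metric.diam F with hτ
  have hτ0 : 0 < τ := by positivity
  have hs0 : 0 ≤ s := by linarith [(Nat.cast_nonneg d : (0 : ℝ) ≤ d)]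
  have hg : g ≠ 0 := by
    rintro rfl
    refine hnonzero 0 L.zero_mem (by simpa using by positivity) ?_
    rw [stft, inner_zero_right]
  have hc : 0 < ‖g‖ ^ 2 := by positivity
  have hws : Summable fun l : L => ‖stft g g (l : PhaseSpace d)‖ ^ 2 :=
    (hframe.hasSum_norm_stft_sq g).summable
  have hqs : Summable fun l : L => (1 + ‖(l : PhaseSpace d)‖) ^ (-s) := by
    refine summable_one_add_norm_rpow L ?_
    have : Module.finrank ℝ (PhaseSpace d) = 2 * d := by simp [two_mul]
    rw [this]
    push_cast
    linarith
  have hq0 : ∀ l : L, 0 ≤ (1 + ‖(l : PhaseSpace d)‖) ^ (-s) := fun l => by positivity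
  -- The radius is r + 3 diam F, as in `hnonzero`; δ is a minimum over finitely many lattice points.
  obtain ⟨δ, hδ, hδw⟩ : ∃ δ : ℝ, 0 < δ ∧ ∀ l : L, ‖(l : PhaseSpace d)‖ < τ + 2 * Metric.diam F →
      δ ≤ ‖stft g g (l : PhaseSpace d)‖ ^ 2 := by
    have hfin : {l : L | ‖(l : PhaseSpace d)‖ < τ + 2 * Metric.diam F}.Finite :=
      (finite_lattice_closedBall L _).subset fun l hl => le_of_lt (Set.mem_ofPred.1 hl)
    obtain ⟨l₀, hl₀, hmin⟩ := hfin.exists_minimalFor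
      (fun l : L => ‖stft g g (l : PhaseSpace d)‖ ^ 2) _ ⟨0, by simp; positivity⟩
    refine ⟨‖stft g g (l₀ : PhaseSpace d)‖ ^ 2, ?_, fun l hl => ?_⟩
    · have : stft g g (l₀ : PhaseSpace d) ≠ 0 := by
        refine hnonzero l₀ l₀.2 ?_
        have hl₀' : ‖(l₀ : PhaseSpace d)‖ < τ + 2 * Metric.diam F := hl₀
        rw [mem_ball_zero_iff]
        linarith
      positivity
    · exact (le_total _ _).elim id (hmin hl)
  set K : ℝ := C ^ 2 * (1 + τ) ^ s with hK
  have hK0 : 0 < K := by positivity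
  set W : ℝ := ∑' l : L, (1 + ‖(l : PhaseSpace d)‖) ^ (-s) with hW
  refine ⟨1 / ‖g‖ ^ 2 * (δ / 2), 1 / ‖g‖ ^ 2 * (2 * (K * W ^ 2) + 1), by positivity, by positivity,
    fun R hR μ h hdec => ?_⟩
  set S : Finset L := (finite_lattice_closedBall L R).toFinset with hSdef
  have hS' : ∀ l : L, l ∈ S ↔ ‖(l : PhaseSpace d)‖ ≤ R := fun l => by simp [hSdef]
  have hS : ∀ l : L, l ∈ S ↔ (l : PhaseSpace d) ∈ Metric.closedBall 0 R := fun l => by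
    rw [hS', mem_closedBall_zero_iff]
  have hBfin : {l : L | ∃ p : PhaseSpace d, ‖p‖ = R ∧ ‖(l : PhaseSpace d) - p‖ < τ}.Finite := by
    refine (finite_lattice_closedBall L (R + τ)).subset ?_
    rintro l ⟨p, hp, hlp⟩
    have := norm_sub_norm_le (l : PhaseSpace d) p
    show ‖(l : PhaseSpace d)‖ ≤ R + τ
    linarith
  set B : Finset L := hBfin.toFinset with hBdef
  have hB : ∀ l : L, l ∈ B ↔ ∃ p : PhaseSpace d, ‖p‖ = R ∧ ‖(l : PhaseSpace d) - p‖ < τ :=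
    fun l => by simp [hBdef]
  have hBcard : (latticeBoundary L τ (Metric.closedBall 0 R)).ncard = B.card := by
    rw [← ncard_inter_eq_card (Ω := latticeBoundary L τ (Metric.closedBall 0 R)) (S := B)]
    · rw [Set.inter_eq_left.2]
      exact fun z hz => hz.1
    · intro l
      rw [hB, mem_latticeBoundary_closedBall_iff hR]
      simp
  have hnear : ∀ p : PhaseSpace d, ‖p‖ = R → ∃ l ∈ B, ‖(l : PhaseSpace d) - p‖ < τ := by
    intro p hp
    obtain ⟨l, hl⟩ := exists_norm_sub_lt_of_isAddFundamentalDomain hF hFb p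
      (show Metric.diam F < τ by linarith)
    exact ⟨l, (hB l).2 ⟨p, hp, hl⟩, hl⟩
  -- This lets the additive 1 from the ceiling be absorbed into `C₂`, uniformly in R.
  have hBpos : (1 : ℝ) ≤ B.card := by
    obtain ⟨p, hp⟩ := exists_norm_eq (PhaseSpace d) hR.le
    obtain ⟨l, hl, -⟩ := hnear p hp
    exact_mod_cast Finset.card_pos.2 ⟨l, hl⟩
  obtain ⟨hsum, hlow, hup⟩ := accSpectrogram_l1_bounds hg hframe hS hdec
  have hlower := interaction_lower_bound (w := fun l : L => ‖stft g g (l : PhaseSpace d)‖ ^ 2)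
    (fun _ => by positivity) hws (S := S) (B := B) (δ := δ) (by
      intro i hi _
      obtain ⟨p, hp, hip⟩ := (hB i).1 hi
      obtain ⟨⟨l, hl, hli⟩, -⟩ := exists_lattice_norm_lt_near_sphere hF hFb hR hp hip
      exact ⟨l, fun h => (((hS' l).1 h).trans_lt hl).false, hδw _ hli⟩) (by
      intro j hj _
      obtain ⟨p, hp, hjp⟩ := (hB j).1 hj
      obtain ⟨-, l, hl, hlj⟩ := exists_lattice_norm_lt_near_sphere hF hFb hR hp hjp
      exact ⟨l, (hS' l).2 hl, hδw _ hlj⟩)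
  have hupper := interaction_upper_bound (w := fun l : L => ‖stft g g (l : PhaseSpace d)‖ ^ 2)
    (q := fun l : L => (1 + ‖(l : PhaseSpace d)‖) ^ (-s)) hws hq0 hqs (S := S) (B := B) hK0.le (by
      intro i hi j hj
      obtain ⟨p, hp, hjp⟩ := exists_sphere_norm_sub_le hR ((hS' i).1 hi)
        (not_le.1 fun h => hj ((hS' j).2 h))
      obtain ⟨ν, hν, hνp⟩ := hnear p hp
      refine ⟨ν, hν, sq_le_mul_rpow_mul_rpow hC hs0 (norm_nonneg _) (norm_nonneg _) hτ0.le
        (norm_nonneg _) (hdecay _) ?_⟩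
      rw [Submodule.coe_sub, Submodule.coe_sub]
      -- ‖j - ν‖ ≤ ‖j - p‖ + ‖ν - p‖ ≤ ‖j - i‖ + τ.
      have h1 := norm_sub_le ((j : PhaseSpace d) - p) ((ν : PhaseSpace d) - p)
      rw [sub_sub_sub_cancel_right] at h1
      linarith)
  refine ⟨hsum, le_trans ?_ hlow, hup.trans ?_⟩
  · rw [hBcard, mul_assoc]
    exact mul_le_mul_of_nonneg_left hlower (by positivity)
  · rw [hBcard, mul_assoc]
    refine mul_le_mul_of_nonneg_left ?_ (by positivity)
    linarith
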